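/- Let $n\ge 1$ and let $\mathbb B^n$ be the open unit ball of $\mathbb C^n$ (Euclidean norm) with Lebesgue measure $\nu$; for $\alpha>-1$ put $d\nu_\alpha(z)=c_\alpha(1-|z|^2)^\alpha\,d\nu(z)$, where $c_\alpha$ is such that $\nu_\alpha(\mathbb B^n)=1$. A growth function is a continuous non-decreasing function $\Phi$ from $[0,\infty)$ onto itself, and $\Phi^{-1}(t)=\inf\{s\ge 0:\Phi(s)\ge t\}$ (the usual inverse when $\Phi$ is injective). Let $\mathscr U$ be the set of growth functions $\Phi$ such that $t\mapsto\Phi(t)/t$ is non-decreasing on $(0,\infty)$ and, for some $q\ge 1$ and $C>0$, $\Phi(st)\le Ct^q\Phi(s)$ for all $s>0$, $t\ge 1$. Let $\mathscr L$ be the set of growth functions $\Phi$ such that $t\mapsto\Phi(t)/t$ is non-increasing on $(0,\infty)$ and, for some $0<p\le 1$ and $C>0$, $\Phi(st)\le Ct^p\Phi(s)$ for all $s>0$, $0<t\le 1$. The Bergman--Orlicz space $A^{\Phi}_\alpha(\mathbb B^n)$ consists of the holomorphic functions $f$ on $\mathbb B^n$ with $\int_{\mathbb B^n}\Phi(|f|)\,d\nu_\alpha<\infty$,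 and carries the Luxemburg (quasi-)norm $\|f\|^{lux}_{\Phi,\alpha}=\inf\{\lambda>0:\int_{\mathbb B^n}\Phi(|f|/\lambda)\,d\nu_\alpha\le 1\}$. Let $\Phi_1,\Phi_2\in\mathscr L\cup\mathscr U$ be such that $\Phi_2/\Phi_1$ is non-decreasing on $(0,\infty)$, and let $\alpha,\beta>-1$. Then $A^{\Phi_1}_\alpha(\mathbb B^n)$ embeds continuously into $A^{\Phi_2}_\beta(\mathbb B^n)$ (that is, $A^{\Phi_1}_\alpha(\mathbb B^n)\subseteq A^{\Phi_2}_\beta(\mathbb B^n)$ and there is a constant $K>0$ with $\|f\|^{lux}_{\Phi_2,\beta}\le K\|f\|^{lux}_{\Phi_1,\alpha}$ for all $f\in A^{\Phi_1}_\alpha(\mathbb B^n)$) if and only if there is a constant $C>0$ such that $$\Phi_1^{-1}(t^{n+1+\alpha})\le\Phi_2^{-1}(Ct^{n+1+\beta})\qquad\text{for all } t\in[1,\infty).$$ -/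

import Mathlib

open MeasureTheory
open scoped NNReal ENNReal

namespace BergmanOrlicz

/-- A growth function: a continuous non-decreasing function from `[0, ∞)` onto itself. -/
structure IsGrowth (Φ : ℝ≥0 → ℝ≥0) : Prop where
  continuous : Continuous Φ
  monotone : Monotone Φ
  surjective : Function.Surjective Φ

/-- `Φ` is of upper type `q`: there is `C > 0` with `Φ (s t) ≤ C t ^ q Φ s` for `s > 0`, `t ≥ 1`. -/
def UpperType (q : ℝ) (Φ : ℝ≥0 → ℝ≥0) : Prop :=
  ∃ C : ℝ≥0, 0 < C ∧ ∀ s t : ℝ≥0, 0 < s → 1 ≤ t → Φ (s * t) ≤ C * t ^ q * Φ s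

/-- `Φ` is of lower type `p`: there is `C > 0` with `Φ (s t) ≤ C t ^ p Φ s` for `s > 0`,
`0 < t ≤ 1`. -/
def LowerType (p : ℝ) (Φ : ℝ≥0 → ℝ≥0) : Prop :=
  ∃ C : ℝ≥0, 0 < C ∧ ∀ s t : ℝ≥0, 0 < s → 0 < t → t ≤ 1 → Φ (s * t) ≤ C * t ^ p * Φ s

/-- The class `𝓤`: growth functions of some upper type `q ≥ 1` such that `t ↦ Φ t / t` is
non-decreasing on `(0, ∞)`. -/
def classU : Set (ℝ≥0 → ℝ≥0) :=
  {Φ | IsGrowth Φ ∧ (∃ q : ℝ, 1 ≤ q ∧ UpperType q Φ) ∧ MonotoneOn (fun t => Φ t / t) (Set.Ioi 0)}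

/-- The class `𝓛`: growth functions of some lower type `0 < p ≤ 1` such that `t ↦ Φ t / t` is
non-increasing on `(0, ∞)`. -/
def classL : Set (ℝ≥0 → ℝ≥0) :=
  {Φ | IsGrowth Φ ∧ (∃ p : ℝ, 0 < p ∧ p ≤ 1 ∧ LowerType p Φ) ∧
    AntitoneOn (fun t => Φ t / t) (Set.Ioi 0)}

/-- The inverse `Φ⁻¹` of a growth function. It is the ordinary inverse if `Φ` is injective, and the
smallest preimage of `t` in general (a member of `classL` may be constant on some interval). -/
noncomputable def inv (Φ : ℝ≥0 → ℝ≥0) (t : ℝ≥0) : ℝ≥0 :=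
  sInf {s | t ≤ Φ s}

/-- The open unit ball of `ℂⁿ`, for the Euclidean norm. -/
def unitBall (n : ℕ) : Set (EuclideanSpace ℂ (Fin n)) :=
  Metric.ball 0 1

/-- The measure `(1 - |z|²) ^ α dν(z)` on the unit ball, where `ν` is Lebesgue measure. -/
noncomputable def weight (n : ℕ) (α : ℝ) : Measure (EuclideanSpace ℂ (Fin n)) :=
  (volume.restrict (unitBall n)).withDensity fun z => ENNReal.ofReal ((1 - ‖z‖ ^ 2) ^ α)

/-- The normalized measure `dν_α(z) = c_α (1 - |z|²) ^ α dν(z)` on the unit ball. -/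
noncomputable def nu (n : ℕ) (α : ℝ) : Measure (EuclideanSpace ℂ (Fin n)) :=
  (weight n α Set.univ)⁻¹ • weight n α

/-- The Bergman-Orlicz space `A^Φ_α` of the unit ball: holomorphic functions `f` on the ball with
`∫ Φ(|f|) dν_α < ∞` (the values of `f` off the ball play no role). -/
def space (n : ℕ) (Φ : ℝ≥0 → ℝ≥0) (α : ℝ) : Set (EuclideanSpace ℂ (Fin n) → ℂ) :=
  {f | DifferentiableOn ℂ f (unitBall n) ∧ ∫⁻ z, (Φ ‖f z‖₊ : ℝ≥0∞) ∂(nu n α) < ∞}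

/-- The Luxemburg (quasi-)norm `inf {r > 0 : ∫ Φ(|f| / r) dν_α ≤ 1}`. -/
noncomputable def luxNorm (n : ℕ) (Φ : ℝ≥0 → ℝ≥0) (α : ℝ)
    (f : EuclideanSpace ℂ (Fin n) → ℂ) : ℝ≥0 :=
  sInf {r : ℝ≥0 | 0 < r ∧ ∫⁻ z, (Φ (‖f z‖₊ / r) : ℝ≥0∞) ∂(nu n α) ≤ 1}

/-- `A^{Φ₁}_α` embeds continuously into `A^{Φ₂}_β`: it is contained in it, and the inclusion is
bounded for the Luxemburg (quasi-)norms. -/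
def EmbedsContinuously (n : ℕ) (Φ₁ : ℝ≥0 → ℝ≥0) (α : ℝ) (Φ₂ : ℝ≥0 → ℝ≥0) (β : ℝ) : Prop :=
  space n Φ₁ α ⊆ space n Φ₂ β ∧
    ∃ C : ℝ≥0, 0 < C ∧ ∀ f ∈ space n Φ₁ α, luxNorm n Φ₂ β f ≤ C * luxNorm n Φ₁ α f

end BergmanOrlicz

/-! Everything rests on one pointwise estimate: if `∫ Φ(|f|/r) dν_α ≤ 1`, then `Φ(|f(a)|/r) ≤ K (1 -
|a|²)^{-(n+1+α)}` (`IsRegular.exists_map_div_le`). At the centre it is a mean value inequality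
(`IsRegular.exists_map_zero_le`); it moves to `a` through the automorphisms of the ball
(`lintegral_weight_moebius`).

Sufficiency: the estimate for `Φ₁` places `|f|`, suitably rescaled, below `Φ₁⁻¹((1 -
|z|²)^{-(n+1+α)})`. Below that level the growth condition and the monotonicity of `Φ₂/Φ₁` give `Φ₂ ≤
C (1 - |z|²)^{α-β} Φ₁`, and the power of `1 - |z|²` is exactly the ratio of the two weights.

Necessity: functions of bounded norm in the first space that reach a fixed multiple of `Φ₁⁻¹((1 -
|a|²)^{-(n+1+α)})` at `a` (`IsRegular.exists_test_function`) are fed into the estimate for `Φ₂`.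

Convexity is never used: upper and lower type trade constants outside `Φ` for constants inside, so
both classes are treated alike. -/

namespace BergmanOrlicz

/-! ### Growth functions: type conditions and inverses -/

/-- The properties shared by the members of `classL` and `classU`. -/
structure IsRegular (Φ : ℝ≥0 → ℝ≥0) : Prop extends IsGrowth Φ where
  map_zero : Φ 0 = 0
  pos : ∀ t, 0 < t → 0 < Φ t
  upper : ∃ q C : ℝ≥0, ∀ s t : ℝ≥0, 1 ≤ t → Φ (s * t) ≤ C * t ^ (q : ℝ) * Φ s
  lower : ∃ p C : ℝ≥0, 0 < p ∧ 0 < C ∧ ∀ s t : ℝ≥0, t ≤ 1 → Φ (s * t) ≤ C * t ^ (p : ℝ) * Φ s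

theorem IsGrowth.map_zero {Φ : ℝ≥0 → ℝ≥0} (h : IsGrowth Φ) : Φ 0 = 0 := by
  obtain ⟨x, hx⟩ := h.surjective 0
  exact le_antisymm ((h.monotone zero_le).trans_eq hx) zero_le

theorem IsRegular.of_mem_classL {Φ : ℝ≥0 → ℝ≥0} (h : Φ ∈ classL) : IsRegular Φ := by
  obtain ⟨hg, ⟨p, hp0, -, C, hC, hlow⟩, hanti⟩ := h
  have h0 := hg.map_zero
  have up : ∀ s t : ℝ≥0, 1 ≤ t → Φ (s * t) ≤ t * Φ s := by
    intro s t ht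
    rcases eq_or_ne s 0 with rfl | hs
    · simp [h0]
    have hs' : 0 < s := pos_iff_ne_zero.2 hs
    have ht' : 0 < t := one_pos.trans_le ht
    have := hanti (Set.mem_Ioi.2 hs') (Set.mem_Ioi.2 (mul_pos hs' ht')) (le_mul_of_one_le_right' ht)
    simp only at this
    rw [div_le_div_iff₀ (mul_pos hs' ht') hs'] at this
    exact le_of_mul_le_mul_right (this.trans_eq (by ring)) hs'
  refine ⟨hg, h0, fun t ht => ?_, ⟨1, 1, fun s t ht => by simpa using up s t ht⟩,
    ⟨⟨p, hp0.le⟩, C, hp0, hC, fun s t ht => ?_⟩⟩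
  · refine pos_iff_ne_zero.2 fun hz => ?_
    obtain ⟨x, hx⟩ := hg.surjective 1
    -- A zero at `t > 0` would spread to all larger arguments by the upper type, against
    -- surjectivity.
    have : Φ (t * max 1 (x / t)) ≤ _ := up t _ (le_max_left _ _)
    rw [hz, mul_zero] at this
    have h2 : x ≤ t * max 1 (x / t) := by
      calc x = t * (x / t) := by field_simp
        _ ≤ _ := by gcongr; exact le_max_right _ _
    have := (hg.monotone h2).trans this
    rw [hx] at this
    simp at this
  · rcases eq_or_ne s 0 with rfl | hs
    · simp [h0]
    rcases eq_or_ne t 0 with rfl | ht0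
    · simp [h0]
    exact hlow s t (pos_iff_ne_zero.2 hs) (pos_iff_ne_zero.2 ht0) ht

theorem IsRegular.of_mem_classU {Φ : ℝ≥0 → ℝ≥0} (h : Φ ∈ classU) : IsRegular Φ := by
  obtain ⟨hg, ⟨q, hq1, C, hC, hup⟩, hmono⟩ := h
  have h0 := hg.map_zero
  refine ⟨hg, h0, fun t ht => ?_, ⟨⟨q, by linarith⟩, C, fun s t ht => ?_⟩,
    ⟨1, 1, one_pos, one_pos, fun s t ht => ?_⟩⟩
  · refine pos_iff_ne_zero.2 fun hz => ?_
    obtain ⟨x, hx⟩ := hg.surjective 1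
    have : Φ (t * max 1 (x / t)) ≤ _ := hup t _ ht (le_max_left _ _)
    rw [hz, mul_zero] at this
    have h2 : x ≤ t * max 1 (x / t) := by
      calc x = t * (x / t) := by field_simp
        _ ≤ _ := by gcongr; exact le_max_right _ _
    have := (hg.monotone h2).trans this
    rw [hx] at this
    simp at this
  · rcases eq_or_ne s 0 with rfl | hs
    · simp [h0]
    exact hup s t (pos_iff_ne_zero.2 hs) ht
  · rcases eq_or_ne s 0 with rfl | hs
    · simp [h0]
    rcases eq_or_ne t 0 with rfl | ht0
    · simp [h0]
    have hs' : 0 < s := pos_iff_ne_zero.2 hs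
    have ht' : 0 < t := pos_iff_ne_zero.2 ht0
    have := hmono (Set.mem_Ioi.2 (mul_pos hs' ht')) (Set.mem_Ioi.2 hs') (mul_le_of_le_one_right' ht)
    simp only at this
    rw [div_le_div_iff₀ (mul_pos hs' ht') hs'] at this
    simpa using le_of_mul_le_mul_right (this.trans_eq (by ring : _ = (t * Φ s) * s)) hs'

theorem IsRegular.of_mem {Φ : ℝ≥0 → ℝ≥0} (h : Φ ∈ classL ∪ classU) : IsRegular Φ :=
  h.elim .of_mem_classL .of_mem_classU

namespace IsRegular

variable {Φ : ℝ≥0 → ℝ≥0}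

theorem exists_map_mul_le (h : IsRegular Φ) (t : ℝ≥0) :
    ∃ K : ℝ≥0, 0 < K ∧ ∀ s, Φ (t * s) ≤ K * Φ s := by
  obtain ⟨q, C, hC⟩ := h.upper
  refine ⟨C * (max t 1) ^ (q : ℝ) + 1, by positivity, fun s => ?_⟩
  calc Φ (t * s) ≤ Φ (s * max t 1) := h.monotone (by rw [mul_comm]; gcongr; exact le_max_left _ _)
    _ ≤ C * (max t 1) ^ (q : ℝ) * Φ s := hC _ _ (le_max_right _ _)
    _ ≤ _ := by gcongr; exact le_self_add

/-- Lower type lets a constant factor be absorbed by dilating the argument; `R` is chosen so that `R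
^ p = D * C + 1`. -/
theorem exists_mul_map_div_le (h : IsRegular Φ) (D : ℝ≥0) :
    ∃ R : ℝ≥0, 1 ≤ R ∧ ∀ s, D * Φ (s / R) ≤ Φ s := by
  obtain ⟨p, C, hp, hC0, hC⟩ := h.lower
  set R : ℝ≥0 := (D * C + 1) ^ (1 / (p : ℝ)) with hR
  have hR1 : 1 ≤ R := NNReal.one_le_rpow (by simp) (by positivity)
  have hR0 : 0 < R := one_pos.trans_le hR1
  have hp' : (p : ℝ) ≠ 0 := by exact_mod_cast hp.ne'
  have hRp : R ^ (p : ℝ) = D * C + 1 := by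
    rw [hR, ← NNReal.rpow_mul, one_div_mul_cancel hp', NNReal.rpow_one]
  refine ⟨R, hR1, fun s => ?_⟩
  have := hC s R⁻¹ (inv_le_one_of_one_le₀ hR1)
  rw [← div_eq_mul_inv, NNReal.inv_rpow, hRp] at this
  calc D * Φ (s / R) ≤ D * (C * (D * C + 1)⁻¹ * Φ s) := by gcongr
    _ = (D * C) / (D * C + 1) * Φ s := by ring
    _ ≤ 1 * Φ s := by
        gcongr
        exact div_le_one_of_le₀ le_self_add zero_le
    _ = Φ s := one_mul _

theorem exists_le_mul_of_map_le (h : IsRegular Φ) (D : ℝ≥0) :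
    ∃ R : ℝ≥0, 1 ≤ R ∧ ∀ x y, Φ x ≤ D * Φ y → x ≤ R * y := by
  -- With `D + 1` in place of `D`, the failure of the claim gives `(D + 1) Φ y ≤ D Φ y`, hence `Φ y
  -- = 0` and then `Φ x = 0` at some `x > 0`.
  obtain ⟨R, hR1, hR⟩ := h.exists_mul_map_div_le (D + 1)
  have hR0 : 0 < R := one_pos.trans_le hR1
  refine ⟨R, hR1, fun x y hxy => ?_⟩
  by_contra! hlt
  have h1 := hR (R * y)
  rw [mul_div_cancel_left₀ _ hR0.ne'] at h1
  have h2 := h1.trans ((h.monotone hlt.le).trans hxy)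
  rw [add_mul, one_mul] at h2
  have h3 : Φ y = 0 := by simpa using h2
  rw [h3, mul_zero] at hxy
  exact (h.pos x (zero_le.trans_lt hlt)).ne' (le_antisymm hxy zero_le)

/-- A regular growth function dominates the logarithm at every scale. -/
theorem exists_one_add_log_mul_le (h : IsRegular Φ) :
    ∃ K : ℝ≥0, 0 < K ∧ ∀ A t : ℝ≥0, 0 < A → 0 < t →
      (1 + Real.log (t / A)) * Φ A ≤ K * Φ t := by
  obtain ⟨p, C, hp, hC0, hC⟩ := h.lower
  obtain ⟨K₁, hK₁, hK⟩ := h.exists_map_mul_le ⟨Real.exp 1, (Real.exp_pos 1).le⟩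
  have hp' : (0 : ℝ) < p := by exact_mod_cast hp
  refine ⟨(1 + 1 / p) * C + K₁, by positivity, fun A t hA ht => ?_⟩
  have hA' : (0 : ℝ) < A := by exact_mod_cast hA
  have ht' : (0 : ℝ) < t := by exact_mod_cast ht
  push_cast
  -- For `A ≤ t`, lower type gains `(A/t)^p`, which beats the logarithm. For `t < A ≤ e t` the
  -- dilation bound suffices, and beyond that the left side is nonpositive.
  rcases le_total A t with hAt | hAt
  · have h1 := hC t (A / t) (div_le_one_of_le₀ hAt zero_le)
    rw [mul_div_cancel₀ _ ht.ne'] at h1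
    have h1' : (Φ A : ℝ) ≤ C * ((A : ℝ) / t) ^ (p : ℝ) * Φ t := by exact_mod_cast h1
    have hx1 : 1 ≤ (t : ℝ) / A := (one_le_div hA').2 (by exact_mod_cast hAt)
    set x : ℝ := (t : ℝ) / A with hx
    have hx0 : 0 < x := by positivity
    have e : ((A : ℝ) / t) ^ (p : ℝ) = (x ^ (p : ℝ))⁻¹ := by
      rw [← Real.inv_rpow hx0.le, hx, inv_div]
    have hl : 1 + Real.log x ≤ (1 + 1 / p) * x ^ (p : ℝ) := by
      have a1 := Real.log_le_rpow_div hx0.le hp'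
      have a2 : 1 ≤ x ^ (p : ℝ) := Real.one_le_rpow hx1 hp'.le
      calc _ ≤ x ^ (p : ℝ) + x ^ (p : ℝ) / p := add_le_add a2 a1
        _ = _ := by ring
    have hxp : 0 < x ^ (p : ℝ) := by positivity
    calc (1 + Real.log x) * Φ A ≤ (1 + 1 / p) * x ^ (p : ℝ) * (C * (x ^ (p : ℝ))⁻¹ * Φ t) := by
          rw [e] at h1'
          exact mul_le_mul hl h1' (by positivity) (by positivity)
      _ = (1 + 1 / p) * C * Φ t := by field_simp
      _ ≤ _ := by gcongr; exact le_add_of_nonneg_right (by positivity)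
  · have hx1 : (t : ℝ) / A ≤ 1 := (div_le_one hA').2 (by exact_mod_cast hAt)
    have hlog : Real.log (t / A) ≤ 0 := Real.log_nonpos (by positivity) hx1
    rcases le_total (A : ℝ) (Real.exp 1 * t) with hle | hle
    · have h2 : (Φ A : ℝ) ≤ K₁ * Φ t := by
        exact_mod_cast (h.monotone (show A ≤ ⟨Real.exp 1, (Real.exp_pos 1).le⟩ * t from hle)).trans
          (hK t)
      calc _ ≤ 1 * (Φ A : ℝ) := by gcongr; linarith
        _ ≤ K₁ * Φ t := by linarith
        _ ≤ _ := by gcongr; exact le_add_of_nonneg_left (by positivity)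
    · have : Real.log (t / A) ≤ -1 := by
        rw [Real.log_le_iff_le_exp (by positivity), Real.exp_neg, div_le_iff₀ hA',
          inv_mul_eq_div, le_div_iff₀ (Real.exp_pos 1)]
        linarith
      calc _ ≤ (0 : ℝ) := mul_nonpos_of_nonpos_of_nonneg (by linarith) (by positivity)
        _ ≤ _ := by positivity

end IsRegular

namespace IsGrowth

variable {Φ : ℝ≥0 → ℝ≥0}

theorem le_map_inv (h : IsGrowth Φ) (t : ℝ≥0) : t ≤ Φ (inv Φ t) := by
  obtain ⟨x, hx⟩ := h.surjective t
  exact (isClosed_le continuous_const h.continuous).csInf_mem (s := {s | t ≤ Φ s})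
    ⟨x, hx.ge⟩ (OrderBot.bddBelow _)

theorem map_inv (h : IsGrowth Φ) (t : ℝ≥0) : Φ (inv Φ t) = t := by
  obtain ⟨x, hx⟩ := h.surjective t
  refine le_antisymm ?_ (h.le_map_inv t)
  rw [← hx]
  exact h.monotone (csInf_le (OrderBot.bddBelow _) (Set.mem_ofPred.2 le_rfl))

/-- Strictness matters: on an interval where `Φ` is constant equal to `t`, `inv` picks the left end.
-/
theorem le_inv_of_map_lt (h : IsGrowth Φ) {x t : ℝ≥0} (hx : Φ x < t) : x ≤ inv Φ t := by
  by_contra! hlt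
  exact absurd ((h.le_map_inv t).trans (h.monotone hlt.le)) hx.not_ge

end IsGrowth

/-! ### Change of variables and rotation invariance -/

/-- `ℂⁿ` with the Euclidean norm. -/
abbrev CSpace (n : ℕ) := EuclideanSpace ℂ (Fin n)

variable {n : ℕ}

/-- Change of variables for injective holomorphic maps. -/
theorem setLIntegral_image_eq_of_hasFDerivAt {s : Set (CSpace n)} (hs : MeasurableSet s)
    {f : CSpace n → CSpace n} {f' : CSpace n → CSpace n →L[ℂ] CSpace n}
    (hf' : ∀ x ∈ s, HasFDerivAt f (f' x) x) (hf : Set.InjOn f s) (g : CSpace n → ℝ≥0∞) :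
    ∫⁻ x in f '' s, g x =
      ∫⁻ x in s, ENNReal.ofReal (‖LinearMap.det (f' x : CSpace n →ₗ[ℂ] CSpace n)‖ ^ 2) *
        g (f x) := by
  rw [lintegral_image_eq_lintegral_abs_det_fderiv_mul volume hs
    (f' := fun x => (f' x).restrictScalars ℝ)
    (fun x hx => ((hf' x hx).restrictScalars ℝ).hasFDerivWithinAt) hf]
  congr with x
  congr 2
  have : ((f' x).restrictScalars ℝ).det =
      Algebra.norm ℝ (LinearMap.det (f' x : CSpace n →ₗ[ℂ] CSpace n)) := by
    rw [← LinearMap.det_restrictScalars]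
    rfl
  rw [this, Algebra.norm_complex_apply, Complex.normSq_eq_norm_sq, abs_of_nonneg (by positivity)]

theorem lintegral_weight (α : ℝ) (g : CSpace n → ℝ≥0∞) :
    ∫⁻ z, g z ∂(weight n α) =
      ∫⁻ z in unitBall n, ENNReal.ofReal ((1 - ‖z‖ ^ 2) ^ α) * g z := by
  rw [weight, lintegral_withDensity_eq_lintegral_mul_non_measurable _ (by fun_prop)
    (Filter.Eventually.of_forall fun _ => ENNReal.ofReal_lt_top)]
  rfl

theorem mem_unitBall {z : CSpace n} : z ∈ unitBall n ↔ ‖z‖ < 1 := by simp [unitBall]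

theorem measurableSet_unitBall : MeasurableSet (unitBall n) := Metric.isOpen_ball.measurableSet

theorem one_sub_norm_sq_pos {z : CSpace n} (hz : ‖z‖ < 1) : 0 < 1 - ‖z‖ ^ 2 := by
  nlinarith [norm_nonneg z]

/-- Invariance of the weighted measures under the circle action. -/
theorem lintegral_weight_smul (α : ℝ) {c : ℂ} (hc : ‖c‖ = 1) (g : CSpace n → ℝ≥0∞) :
    ∫⁻ z, g (c • z) ∂(weight n α) = ∫⁻ z, g z ∂(weight n α) := by
  have hc0 : c ≠ 0 := by rintro rfl; simp at hc
  have himg : (fun z : CSpace n => c • z) '' unitBall n = unitBall n := by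
    ext w
    constructor
    · rintro ⟨z, hz, rfl⟩
      rw [mem_unitBall] at *
      simpa [norm_smul, hc] using hz
    · intro hw
      rw [mem_unitBall] at hw
      exact ⟨c⁻¹ • w, by simpa [mem_unitBall, norm_smul, hc] using hw, by simp [smul_smul, hc0]⟩
  have key := setLIntegral_image_eq_of_hasFDerivAt (s := unitBall n) measurableSet_unitBall
    (f := fun z => c • z) (f' := fun _ => c • ContinuousLinearMap.id ℂ _)
    (fun x _ => (hasFDerivAt_id x).const_smul c)
    (fun x _ y _ h => smul_right_injective _ hc0 h)
    (fun z => ENNReal.ofReal ((1 - ‖z‖ ^ 2) ^ α) * g z)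
  rw [lintegral_weight, lintegral_weight, ← himg, key, himg]
  refine setLIntegral_congr_fun measurableSet_unitBall fun z _ => ?_
  simp [norm_smul, hc, LinearMap.det_smul]

/-! ### Automorphisms of the ball -/

section Moebius

variable (a : CSpace n)

/-- The defect `√(1 - |a|²)` of a point of the ball. -/
noncomputable def defect : ℝ := √(1 - ‖a‖ ^ 2)

/-- The involutive automorphism of the ball that exchanges `0` and `a`. -/
noncomputable def moebius (z : CSpace n) : CSpace n :=
  (1 - inner ℂ a z)⁻¹ • ((1 - inner ℂ a z / (1 + defect a)) • a - (defect a : ℂ) • z)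

variable {a}

theorem defect_pos (ha : ‖a‖ < 1) : 0 < defect a := Real.sqrt_pos.2 (one_sub_norm_sq_pos ha)

theorem defect_sq (ha : ‖a‖ < 1) : defect a ^ 2 = 1 - ‖a‖ ^ 2 :=
  Real.sq_sqrt (one_sub_norm_sq_pos ha).le

theorem inner_self_eq (ha : ‖a‖ < 1) : inner ℂ a a = 1 - (defect a : ℂ) ^ 2 := by
  rw [inner_self_eq_norm_sq_to_K]
  have := defect_sq ha
  have h : ‖a‖ ^ 2 = 1 - defect a ^ 2 := by linarith
  have h' : (‖a‖ : ℂ) ^ 2 = 1 - (defect a : ℂ) ^ 2 := by exact_mod_cast h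
  exact h'

theorem one_add_defect_ne_zero (ha : ‖a‖ < 1) : (1 + defect a : ℂ) ≠ 0 := by
  have : (1 + defect a : ℝ) ≠ 0 := by linarith [defect_pos ha]
  exact_mod_cast this

theorem one_sub_inner_ne_zero (ha : ‖a‖ < 1) {z : CSpace n} (hz : ‖z‖ < 1) :
    1 - inner ℂ a z ≠ 0 := by
  intro h
  have h1 : inner ℂ a z = 1 := (sub_eq_zero.1 h).symm
  have h2 := norm_inner_le_norm (𝕜 := ℂ) a z
  rw [h1, norm_one] at h2
  nlinarith [norm_nonneg a, norm_nonneg z]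

theorem one_sub_norm_le_norm_one_sub_inner {z : CSpace n} (hz : ‖z‖ < 1) :
    1 - ‖a‖ ≤ ‖1 - inner ℂ a z‖ := by
  have h2 := norm_inner_le_norm (𝕜 := ℂ) a z
  have h3 := norm_sub_norm_le (1 : ℂ) (inner ℂ a z)
  rw [norm_one] at h3
  nlinarith [norm_nonneg a, norm_nonneg z]

/-- With `s = defect a`, the usual coefficient `(1 - s)/|a|²` of the projection onto `a` is `1/(1 +
s)`. Hence `a = 0` is no exception, and this and the later identities are rational in `s` and `⟨a,
z⟩`. -/
theorem one_sub_inner_moebius (ha : ‖a‖ < 1) {z : CSpace n} (hz : ‖z‖ < 1) :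
    1 - inner ℂ a (moebius a z) = (defect a : ℂ) ^ 2 / (1 - inner ℂ a z) := by
  have hd := one_sub_inner_ne_zero ha hz
  have hs := one_add_defect_ne_zero ha
  rw [moebius, inner_smul_right, inner_sub_right, inner_smul_right, inner_smul_right,
    inner_self_eq ha]
  field_simp
  ring

theorem one_sub_norm_moebius_sq (ha : ‖a‖ < 1) {z : CSpace n} (hz : ‖z‖ < 1) :
    1 - ‖moebius a z‖ ^ 2 = (1 - ‖z‖ ^ 2) * (defect a ^ 2 / ‖1 - inner ℂ a z‖ ^ 2) := by
  have hd := one_sub_inner_ne_zero ha hz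
  have hs : (1 + defect a : ℝ) ≠ 0 := by linarith [defect_pos ha]
  have hd' : ‖1 - inner ℂ a z‖ ^ 2 ≠ 0 := by simpa using hd
  have key : ‖(1 - inner ℂ a z / (1 + defect a)) • a - (defect a : ℂ) • z‖ ^ 2 =
      ‖1 - inner ℂ a z‖ ^ 2 - defect a ^ 2 * (1 - ‖z‖ ^ 2) := by
    rw [norm_sub_sq (𝕜 := ℂ), inner_smul_left, inner_smul_right, norm_smul, norm_smul]
    set c := inner ℂ a z
    have hna : ‖a‖ ^ 2 = 1 - defect a ^ 2 := by linarith [defect_sq ha]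
    have hw : c / (1 + defect a : ℂ) = (1 + defect a : ℝ)⁻¹ * c := by
      push_cast
      rw [div_eq_inv_mul]
    rw [hw, mul_pow, mul_pow, hna]
    simp only [← Complex.normSq_eq_norm_sq]
    simp only [Complex.normSq_apply, Complex.sub_re, Complex.sub_im, Complex.one_re,
      Complex.one_im, RCLike.re_to_complex, Complex.mul_re, Complex.mul_im, Complex.conj_re,
      Complex.conj_im, Complex.ofReal_re, Complex.ofReal_im]
    field_simp
    ring
  rw [moebius, norm_smul, mul_pow, norm_inv, key]
  field_simp
  ring

theorem norm_moebius_lt_one (ha : ‖a‖ < 1) {z : CSpace n} (hz : ‖z‖ < 1) : ‖moebius a z‖ < 1 := by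
  have h := one_sub_norm_moebius_sq ha hz
  have : 0 < 1 - ‖moebius a z‖ ^ 2 := by
    rw [h]
    have := one_sub_norm_sq_pos hz
    have := defect_pos ha
    have := norm_pos_iff.2 (one_sub_inner_ne_zero ha hz)
    positivity
  nlinarith [norm_nonneg (moebius a z)]

theorem moebius_zero : moebius a 0 = a := by simp [moebius]

theorem moebius_moebius (ha : ‖a‖ < 1) {z : CSpace n} (hz : ‖z‖ < 1) :
    moebius a (moebius a z) = z := by
  have hd := one_sub_inner_ne_zero ha hz
  have hs := one_add_defect_ne_zero ha
  have h0 : (defect a : ℂ) ≠ 0 := by exact_mod_cast (defect_pos ha).ne'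
  have h1 := one_sub_inner_moebius ha hz
  have h2 : inner ℂ a (moebius a z) = 1 - (defect a : ℂ) ^ 2 / (1 - inner ℂ a z) := by
    rw [← h1]; ring
  rw [moebius, h2, moebius]
  simp only [smul_sub, smul_smul]
  match_scalars <;> field_simp <;> ring

theorem image_moebius_unitBall (ha : ‖a‖ < 1) : moebius a '' unitBall n = unitBall n := by
  ext w
  simp only [Set.mem_image, mem_unitBall]
  constructor
  · rintro ⟨z, hz, rfl⟩
    exact norm_moebius_lt_one ha hz
  · exact fun hw => ⟨moebius a w, norm_moebius_lt_one ha hw, moebius_moebius ha hw⟩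

theorem injOn_moebius (ha : ‖a‖ < 1) : Set.InjOn (moebius a) (unitBall n) := by
  intro x hx y hy h
  rw [mem_unitBall] at hx hy
  rw [← moebius_moebius ha hx, h, moebius_moebius ha hy]

variable (a) in
/-- The derivative of `moebius a` at `z`, a multiple of a rank one perturbation of the identity. -/
noncomputable def moebiusDeriv (z : CSpace n) : CSpace n →L[ℂ] CSpace n :=
  (-((defect a : ℂ) / (1 - inner ℂ a z))) • (ContinuousLinearMap.id ℂ _ +
    (innerSL ℂ a).smulRight ((defect a : ℂ)⁻¹ • ((1 + defect a : ℂ)⁻¹ • a - moebius a z)))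

theorem hasFDerivAt_moebius (ha : ‖a‖ < 1) {z : CSpace n} (hz : ‖z‖ < 1) :
    HasFDerivAt (moebius a) (moebiusDeriv a z) z := by
  have hd := one_sub_inner_ne_zero ha hz
  have h0 : (defect a : ℂ) ≠ 0 := by exact_mod_cast (defect_pos ha).ne'
  have hs := one_add_defect_ne_zero ha
  have hl : HasFDerivAt (fun z : CSpace n => inner ℂ a z) (innerSL ℂ a) z :=
    (innerSL ℂ a).hasFDerivAt
  have h1 : HasFDerivAt (fun z : CSpace n => (1 - inner ℂ a z)⁻¹)
      (-(((1 - inner ℂ a z) ^ 2)⁻¹ : ℂ) • (-(innerSL ℂ a))) z :=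
    (hasDerivAt_inv hd).comp_hasFDerivAt z (hl.const_sub 1)
  have h2 : HasFDerivAt (fun z : CSpace n => 1 - inner ℂ a z / (1 + defect a))
      (-((1 + defect a : ℂ)⁻¹ • innerSL ℂ a)) z := by
    have := (hl.const_mul (1 + defect a : ℂ)⁻¹).const_sub 1
    simpa only [← div_eq_inv_mul] using this
  have h3 := h1.smul ((h2.smul_const a).sub ((hasFDerivAt_id z).const_smul (defect a : ℂ)))
  refine h3.congr_fderiv ?_
  ext1 h
  simp only [moebiusDeriv, moebius, add_apply, smul_apply,
    sub_apply, neg_apply, ContinuousLinearMap.smulRight_apply, ContinuousLinearMap.id_apply,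
    innerSL_apply_apply, smul_eq_mul, Pi.sub_apply, Pi.smul_apply, id_eq]
  simp only [smul_sub, smul_add, smul_smul]
  match_scalars
  all_goals field_simp
  all_goals ring

/-- The rank one perturbation has determinant `s / (1 - ⟨a, z⟩)`, with `s = defect a`, by the
transvection formula; the scalar in front contributes `n` more factors of the same modulus. -/
theorem norm_det_moebiusDeriv (ha : ‖a‖ < 1) {z : CSpace n} (hz : ‖z‖ < 1) :
    ‖LinearMap.det (moebiusDeriv a z : CSpace n →ₗ[ℂ] CSpace n)‖ =
      (defect a / ‖1 - inner ℂ a z‖) ^ (n + 1) := by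
  have hd := one_sub_inner_ne_zero ha hz
  have h0 : (defect a : ℂ) ≠ 0 := by exact_mod_cast (defect_pos ha).ne'
  have hs := one_add_defect_ne_zero ha
  have e : (moebiusDeriv a z : CSpace n →ₗ[ℂ] CSpace n) =
      (-((defect a : ℂ) / (1 - inner ℂ a z))) •
        LinearMap.transvection (innerSL ℂ a : CSpace n →ₗ[ℂ] ℂ)
          ((defect a : ℂ)⁻¹ • ((1 + defect a : ℂ)⁻¹ • a - moebius a z)) := by
    ext1 h
    simp [moebiusDeriv, LinearMap.transvection.apply, add_comm]
  have h2 : inner ℂ a (moebius a z) = 1 - (defect a : ℂ) ^ 2 / (1 - inner ℂ a z) := by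
    rw [← one_sub_inner_moebius ha hz]; ring
  have h3 : 1 + (innerSL ℂ a : CSpace n →ₗ[ℂ] ℂ)
      ((defect a : ℂ)⁻¹ • ((1 + defect a : ℂ)⁻¹ • a - moebius a z)) =
      (defect a : ℂ) / (1 - inner ℂ a z) := by
    simp only [ContinuousLinearMap.coe_coe, innerSL_apply_apply, inner_smul_right, inner_sub_right,
      h2, inner_self_eq ha]
    field_simp
    ring
  rw [e, LinearMap.det_smul, LinearMap.transvection.det, h3, norm_mul, norm_pow, norm_neg,
    finrank_euclideanSpace_fin, ← pow_succ, norm_div, Complex.norm_real,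
    Real.norm_of_nonneg (defect_pos ha).le]

/-- The conformal factor `(1 - |a|²) / |1 - ⟨z, a⟩|²` of the automorphism `moebius a`. -/
noncomputable def moebiusFactor (a z : CSpace n) : ℝ := defect a ^ 2 / ‖1 - inner ℂ a z‖ ^ 2

/-- The behaviour of the weighted measures under the automorphisms of the ball. -/
theorem lintegral_weight_moebius (α : ℝ) (ha : ‖a‖ < 1) (g : CSpace n → ℝ≥0∞) :
    ∫⁻ z, g z ∂(weight n α) = ∫⁻ z, ENNReal.ofReal
      (moebiusFactor a z ^ ((n : ℝ) + 1 + α)) * g (moebius a z) ∂(weight n α) := by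
  have key := setLIntegral_image_eq_of_hasFDerivAt (s := unitBall n) measurableSet_unitBall
    (f := moebius a) (f' := moebiusDeriv a)
    (fun x hx => hasFDerivAt_moebius ha (mem_unitBall.1 hx)) (injOn_moebius ha)
    (fun z => ENNReal.ofReal ((1 - ‖z‖ ^ 2) ^ α) * g z)
  rw [image_moebius_unitBall ha] at key
  rw [lintegral_weight, lintegral_weight, key]
  refine setLIntegral_congr_fun measurableSet_unitBall fun z hz => ?_
  rw [mem_unitBall] at hz
  have hm : 0 < moebiusFactor a z := by
    have := defect_pos ha
    have := norm_pos_iff.2 (one_sub_inner_ne_zero ha hz)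
    unfold moebiusFactor
    positivity
  have hz' := one_sub_norm_sq_pos hz
  rw [← mul_assoc, ← mul_assoc, ← ENNReal.ofReal_mul (by positivity),
    ← ENNReal.ofReal_mul (by positivity), norm_det_moebiusDeriv ha hz,
    one_sub_norm_moebius_sq ha hz, ← moebiusFactor, Real.mul_rpow hz'.le hm.le]
  congr 2
  have : ((defect a / ‖1 - inner ℂ a z‖) ^ (n + 1)) ^ 2 = moebiusFactor a z ^ ((n : ℝ) + 1) := by
    rw [moebiusFactor, ← pow_mul, mul_comm, pow_mul, div_pow, ← Real.rpow_natCast]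
    push_cast
    rfl
  rw [this, Real.rpow_add hm ((n : ℝ) + 1) α]
  ring

theorem moebiusFactor_le (ha : ‖a‖ < 1) {z : CSpace n} (hz : ‖z‖ < 1) :
    moebiusFactor a z ≤ 4 / (1 - ‖a‖ ^ 2) := by
  have h1 := one_sub_norm_le_norm_one_sub_inner (a := a) hz
  have h2 : 0 < 1 - ‖a‖ := by linarith
  have h3 := one_sub_norm_sq_pos ha
  have h4 := norm_nonneg a
  have h6 := norm_pos_iff.2 (one_sub_inner_ne_zero ha hz)
  rw [moebiusFactor, defect_sq ha, div_le_div_iff₀ (by positivity) h3]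
  have h5 : (1 - ‖a‖) ^ 2 ≤ ‖1 - inner ℂ a z‖ ^ 2 := by gcongr
  calc (1 - ‖a‖ ^ 2) * (1 - ‖a‖ ^ 2) = (1 + ‖a‖) ^ 2 * (1 - ‖a‖) ^ 2 := by ring
    _ ≤ 2 ^ 2 * ‖1 - inner ℂ a z‖ ^ 2 := by gcongr; linarith
    _ = _ := by norm_num

end Moebius

/-! ### Normalization of the weighted measures -/

theorem ae_weight_mem_unitBall (α : ℝ) : ∀ᵐ z ∂(weight n α), ‖z‖ < 1 := by
  refine (withDensity_absolutelyContinuous _ _).ae_le ?_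
  filter_upwards [ae_restrict_mem measurableSet_unitBall] with z hz using mem_unitBall.1 hz

/-- In polar coordinates the only singularity is `(1 - y)^α` at `y = 1`, integrable since `α > -1`;
the remaining factors are continuous on `[0, 1]`. -/
theorem weight_univ_lt_top (hn : 1 ≤ n) {α : ℝ} (hα : -1 < α) : weight n α Set.univ < ∞ := by
  have : Nonempty (Fin n) := ⟨⟨0, hn⟩⟩
  have h1 : IntegrableOn (fun y : ℝ => (1 - y) ^ α) (Set.Icc 0 1) := by
    have := (intervalIntegral.intervalIntegrable_rpow' (a := 0) (b := 1) hα).comp_sub_left 1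
    rw [sub_zero, sub_self] at this
    exact (intervalIntegrable_iff_integrableOn_Icc_of_le zero_le_one).1 this.symm
  have h2 : IntegrableOn (fun y : ℝ => (1 - y) ^ α *
      (y ^ (Module.finrank ℝ (CSpace n) - 1) * (1 + y) ^ α)) (Set.Icc 0 1) := by
    refine h1.mul_continuousOn (ContinuousOn.mul (by fun_prop) ?_) isCompact_Icc
    exact ContinuousOn.rpow_const (by fun_prop) fun y hy => Or.inl (by linarith [hy.1])
  have h3 : IntegrableOn (fun y : ℝ => y ^ (Module.finrank ℝ (CSpace n) - 1) •
      (1 - y ^ 2) ^ α) (Set.Ioo 0 1) := by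
    refine (h2.mono_set Set.Ioo_subset_Icc_self).congr_fun (fun y hy => ?_) measurableSet_Ioo
    have e : 1 - y ^ 2 = (1 - y) * (1 + y) := by ring
    simp only [smul_eq_mul]
    rw [e, Real.mul_rpow (by linarith [hy.2]) (by linarith [hy.1])]
    ring
  have h4 := (integrableOn_fun_norm_addHaar (E := CSpace n) volume
    (f := fun y : ℝ => (1 - y ^ 2) ^ α) (r := 1)).2 h3
  rw [weight, withDensity_apply _ MeasurableSet.univ, Measure.restrict_univ]
  exact h4.lintegral_lt_top

theorem weight_univ_ne_zero (n : ℕ) (α : ℝ) : weight n α Set.univ ≠ 0 := by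
  rw [weight, withDensity_apply _ MeasurableSet.univ, Measure.restrict_univ]
  refine ((setLIntegral_pos_iff (by fun_prop)).2 ?_).ne'
  refine (Metric.measure_ball_pos volume (0 : CSpace n) one_pos).trans_le (measure_mono ?_)
  refine fun z hz => ⟨?_, hz⟩
  have := one_sub_norm_sq_pos (mem_unitBall.1 hz)
  rw [Function.mem_support]
  exact (ENNReal.ofReal_pos.2 (by positivity)).ne'

theorem isProbabilityMeasure_nu (hn : 1 ≤ n) {α : ℝ} (hα : -1 < α) :
    IsProbabilityMeasure (nu n α) :=
  ⟨by
    rw [nu, Measure.smul_apply, smul_eq_mul]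
    exact ENNReal.inv_mul_cancel (weight_univ_ne_zero n α) (weight_univ_lt_top hn hα).ne⟩

theorem lintegral_nu (α : ℝ) (g : CSpace n → ℝ≥0∞) :
    ∫⁻ z, g z ∂(nu n α) = (weight n α Set.univ)⁻¹ * ∫⁻ z, g z ∂(weight n α) := by
  rw [nu, lintegral_smul_measure, smul_eq_mul]

theorem ae_nu_mem_unitBall (α : ℝ) : ∀ᵐ z ∂(nu n α), ‖z‖ < 1 :=
  Measure.ae_smul_measure (ae_weight_mem_unitBall α) _

theorem lintegral_nu_smul (α : ℝ) {c : ℂ} (hc : ‖c‖ = 1) (g : CSpace n → ℝ≥0∞) :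
    ∫⁻ z, g (c • z) ∂(nu n α) = ∫⁻ z, g z ∂(nu n α) := by
  rw [lintegral_nu, lintegral_nu, lintegral_weight_smul α hc]

theorem lintegral_nu_moebius (α : ℝ) {a : CSpace n} (ha : ‖a‖ < 1) (g : CSpace n → ℝ≥0∞) :
    ∫⁻ z, g z ∂(nu n α) = ∫⁻ z, ENNReal.ofReal
      (moebiusFactor a z ^ ((n : ℝ) + 1 + α)) * g (moebius a z) ∂(nu n α) := by
  rw [lintegral_nu, lintegral_nu, lintegral_weight_moebius α ha]

/-! ### Mean value inequalities and the pointwise estimate -/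

/-- The logarithmic mean value inequality, for analytic functions on the closed unit disc. -/
theorem log_norm_le_circleAverage {g : ℂ → ℂ} (hg : AnalyticOnNhd ℂ g (Metric.closedBall 0 1))
    (h0 : g 0 ≠ 0) : Real.log ‖g 0‖ ≤ Real.circleAverage (fun z => Real.log ‖g z‖) 0 1 := by
  have hg' : AnalyticOnNhd ℂ g (Metric.closedBall 0 |1|) := by simpa using hg
  rw [hg'.circleAverage_log_norm one_ne_zero h0]
  -- In Jensen's formula each zero `u` of the disc contributes its multiplicity times `log (1/|u|) ≥
  -- 0`.
  refine le_add_of_nonneg_left (finsum_nonneg fun u => ?_)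
  by_cases hu : u ∈ Metric.closedBall (0 : ℂ) |1|
  · refine mul_nonneg ?_ ?_
    · exact_mod_cast (MeromorphicOn.AnalyticOnNhd.divisor_nonneg hg') u
    · rw [zero_sub, norm_neg, one_mul]
      rcases eq_or_ne u 0 with rfl | hu0
      · simp
      · refine Real.log_nonneg ((one_le_inv₀ (norm_pos_iff.2 hu0)).2 (by simpa using hu))
  · simp [Function.locallyFinsuppWithin.apply_eq_zero_of_notMem _ hu]

/-- The mean value inequality for `Φ ∘ |g|`, up to a constant. -/
theorem IsRegular.exists_map_le_circle {Φ : ℝ≥0 → ℝ≥0} (h : IsRegular Φ) :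
    ∃ K : ℝ≥0, 0 < K ∧ ∀ g : ℂ → ℂ, AnalyticOnNhd ℂ g (Metric.closedBall 0 1) →
      ENNReal.ofReal (2 * Real.pi) * Φ ‖g 0‖₊ ≤
        K * ∫⁻ θ in Set.Ioc 0 (2 * Real.pi), Φ ‖g (circleMap 0 1 θ)‖₊ := by
  obtain ⟨K, hK, hlog⟩ := h.exists_one_add_log_mul_le
  refine ⟨K, hK, fun g hg => ?_⟩
  rcases eq_or_ne (g 0) 0 with h0 | h0
  · simp [h0, h.map_zero]
  -- `Φ ∘ |g|` need not be subharmonic. Instead `(1 + log (|g|/A)) Φ A ≤ K Φ(|g|)` is averaged over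
  -- the circle: by the inequality for `log |g|`, the left side averages to at least `Φ A`.
  set A : ℝ≥0 := ‖g 0‖₊ with hA
  have hA0 : 0 < A := by simpa [hA] using h0
  have hA' : (0 : ℝ) < A := by exact_mod_cast hA0
  have hsph : Metric.sphere (0 : ℂ) |1| ⊆ Metric.closedBall 0 1 := by
    rw [abs_one]; exact Metric.sphere_subset_closedBall
  have hcont : ContinuousOn (fun z => (Φ ‖g z‖₊ : ℝ)) (Metric.sphere 0 |1|) :=
    NNReal.continuous_coe.comp_continuousOn
      (h.continuous.comp_continuousOn ((hg.continuousOn.mono hsph).nnnorm))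
  have hΦi : CircleIntegrable (fun z => (Φ ‖g z‖₊ : ℝ)) 0 1 :=
    hcont.circleIntegrable'
  have hli : CircleIntegrable (fun z => Real.log ‖g z‖) 0 1 :=
    MeromorphicOn.circleIntegrable_log_norm fun z hz => (hg z (hsph hz)).meromorphicAt
  have hne : g ⁻¹' {0}ᶜ ∈ Filter.codiscreteWithin (Metric.sphere (0 : ℂ) |1|) :=
    Filter.codiscreteWithin_mono hsph
      (hg.preimage_zero_mem_codiscreteWithin h0 (by simp)
        ⟨⟨0, by simp⟩, (convex_closedBall (0 : ℂ) 1).isPreconnected⟩)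
  set f₁ : ℂ → ℝ := fun z => (1 - Real.log A) * Φ A + Φ A * Real.log ‖g z‖ with hf₁
  have hf₁i : CircleIntegrable f₁ 0 1 :=
    (circleIntegrable_const _ _ _).add (hli.const_mul _)
  -- At a zero of `g` the convention `log 0 = 0` may break the bound, so `f₁` is replaced by `0`
  -- there; such points are too few to change the average.
  set f₂ : ℂ → ℝ := fun z => if g z = 0 then 0 else f₁ z with hf₂
  have hf₁₂ : f₁ =ᶠ[Filter.codiscreteWithin (Metric.sphere (0 : ℂ) |1|)] f₂ := by
    filter_upwards [hne] with z hz
    have : g z ≠ 0 := hz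
    simp [hf₂, this]
  have e1 : Real.circleAverage f₁ 0 1 = (1 - Real.log A) * Φ A +
      Φ A * Real.circleAverage (fun z => Real.log ‖g z‖) 0 1 := by
    have := Real.circleAverage_fun_add (circleIntegrable_const ((1 - Real.log A) * Φ A) 0 1)
      (f₂ := fun z => (Φ A : ℝ) * Real.log ‖g z‖) (hli.const_mul (Φ A : ℝ))
    rw [Real.circleAverage_const] at this
    rw [hf₁, this]
    congr 1
    exact Real.circleAverage_fun_smul (a := (Φ A : ℝ)) (f := fun z => Real.log ‖g z‖)
  have hlower : (Φ A : ℝ) ≤ Real.circleAverage f₁ 0 1 := by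
    rw [e1]
    have := mul_le_mul_of_nonneg_left (log_norm_le_circleAverage hg h0) (Φ A).coe_nonneg
    have e : ‖g 0‖ = A := rfl
    rw [e] at this
    linarith
  have hupper : Real.circleAverage f₁ 0 1 ≤
      Real.circleAverage (fun z => (K : ℝ) * Φ ‖g z‖₊) 0 1 := by
    rw [Real.circleAverage_congr_codiscreteWithin hf₁₂ one_ne_zero]
    refine Real.circleAverage_mono (hf₁i.congr_codiscreteWithin hf₁₂) (hΦi.const_mul _)
      fun z _ => ?_
    by_cases hz : g z = 0
    · simp only [hf₂, hz, if_true]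
      positivity
    · have hz' : 0 < ‖g z‖₊ := by simpa using hz
      have := hlog A ‖g z‖₊ hA0 hz'
      rw [Real.log_div (by simpa using hz) hA'.ne', coe_nnnorm] at this
      simp only [hf₂, hz, if_false, hf₁]
      linarith
  have hfin := hlower.trans hupper
  rw [Real.circleAverage_def, smul_eq_mul, inv_mul_eq_div, le_div_iff₀ Real.two_pi_pos,
    intervalIntegral.integral_of_le Real.two_pi_pos.le] at hfin
  have hint : IntegrableOn (fun θ => (K : ℝ) * Φ ‖g (circleMap 0 1 θ)‖₊)
      (Set.Ioc 0 (2 * Real.pi)) :=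
    (intervalIntegrable_iff_integrableOn_Ioc_of_le Real.two_pi_pos.le).1 (hΦi.const_mul _)
  have := ENNReal.ofReal_le_ofReal hfin
  rw [ofReal_integral_eq_lintegral_ofReal hint
    (Filter.Eventually.of_forall fun θ => by positivity), mul_comm,
    ENNReal.ofReal_mul Real.two_pi_pos.le, ENNReal.ofReal_coe_nnreal] at this
  refine this.trans_eq ?_
  rw [← lintegral_const_mul' _ _ ENNReal.coe_ne_top]
  refine lintegral_congr fun θ => ?_
  rw [ENNReal.ofReal_mul K.coe_nonneg, ENNReal.ofReal_coe_nnreal, ENNReal.ofReal_coe_nnreal]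

/-- The mean value inequality at the centre of the ball. -/
theorem IsRegular.exists_map_zero_le {Φ : ℝ≥0 → ℝ≥0} (h : IsRegular Φ) (hn : 1 ≤ n) {α : ℝ}
    (hα : -1 < α) :
    ∃ K : ℝ≥0, 0 < K ∧ ∀ f : CSpace n → ℂ, DifferentiableOn ℂ f (unitBall n) →
      (Φ ‖f 0‖₊ : ℝ≥0∞) ≤ K * ∫⁻ z, Φ ‖f z‖₊ ∂(nu n α) := by
  obtain ⟨K, hK, hcirc⟩ := h.exists_map_le_circle
  refine ⟨K, hK, fun f hf => ?_⟩
  have := isProbabilityMeasure_nu hn hα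
  -- Cutting off outside the ball, where `f` is arbitrary, provides the measurability needed for
  -- Tonelli. The circle inequality on each disc `ζ ↦ ζ • z` is then integrated in `z`, using
  -- rotation invariance.
  set G : CSpace n → ℝ≥0∞ := (unitBall n).indicator fun z => Φ ‖f z‖₊ with hG
  have hGm : Measurable G := by
    classical
    rw [hG, ← Set.piecewise_eq_indicator]
    refine ContinuousOn.measurable_piecewise ?_ continuousOn_const measurableSet_unitBall
    exact ENNReal.continuous_coe.comp_continuousOn
      (h.continuous.comp_continuousOn hf.continuousOn.nnnorm)
  have hGf : ∀ z, ‖z‖ < 1 → G z = Φ ‖f z‖₊ := fun z hz =>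
    Set.indicator_of_mem (mem_unitBall.2 hz) _
  have hpt : ∀ z : CSpace n, ‖z‖ < 1 → ENNReal.ofReal (2 * Real.pi) * Φ ‖f 0‖₊ ≤
      K * ∫⁻ θ in Set.Ioc 0 (2 * Real.pi), G (circleMap 0 1 θ • z) := by
    intro z hz
    have hopen : IsOpen {ζ : ℂ | ‖ζ • z‖ < 1} := isOpen_lt (by fun_prop) continuous_const
    have hd : DifferentiableOn ℂ (fun ζ : ℂ => f (ζ • z)) {ζ : ℂ | ‖ζ • z‖ < 1} :=
      hf.comp (by fun_prop) fun ζ hζ => mem_unitBall.2 hζ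
    have hle : ∀ ζ : ℂ, ‖ζ‖ ≤ 1 → ‖ζ • z‖ < 1 := fun ζ hζ => by
      rw [norm_smul]
      exact (mul_le_of_le_one_left (norm_nonneg _) hζ).trans_lt hz
    have := hcirc (fun ζ : ℂ => f (ζ • z)) ((hd.analyticOnNhd hopen).mono fun ζ hζ =>
      hle ζ (by simpa using hζ))
    simp only [zero_smul] at this
    refine this.trans_eq ?_
    congr 1
    refine lintegral_congr fun θ => (hGf _ (hle _ ?_)).symm
    simp
  have hint : ∫⁻ z, (∫⁻ θ in Set.Ioc 0 (2 * Real.pi), G (circleMap 0 1 θ • z)) ∂(nu n α) =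
      ENNReal.ofReal (2 * Real.pi) * ∫⁻ z, G z ∂(nu n α) := by
    rw [lintegral_lintegral_swap]
    · rw [setLIntegral_congr_fun (g := fun _ => ∫⁻ z, G z ∂(nu n α)) measurableSet_Ioc
        fun θ _ => lintegral_nu_smul α (by simp) G]
      simp [mul_comm]
    · refine (hGm.comp ?_).aemeasurable
      fun_prop
  have hGint : ∫⁻ z, G z ∂(nu n α) = ∫⁻ z, Φ ‖f z‖₊ ∂(nu n α) :=
    lintegral_congr_ae ((ae_nu_mem_unitBall α).mono hGf)
  have hmain : ENNReal.ofReal (2 * Real.pi) * Φ ‖f 0‖₊ ≤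
      ENNReal.ofReal (2 * Real.pi) * (K * ∫⁻ z, Φ ‖f z‖₊ ∂(nu n α)) := by
    calc _ = ∫⁻ _, ENNReal.ofReal (2 * Real.pi) * Φ ‖f 0‖₊ ∂(nu n α) := by simp
      _ ≤ ∫⁻ z, K * (∫⁻ θ in Set.Ioc 0 (2 * Real.pi), G (circleMap 0 1 θ • z)) ∂(nu n α) :=
        lintegral_mono_ae ((ae_nu_mem_unitBall α).mono hpt)
      _ = _ := by
        rw [lintegral_const_mul' _ _ ENNReal.coe_ne_top, hint, hGint, mul_left_comm]
  exact (ENNReal.mul_le_mul_iff_right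
    (ENNReal.ofReal_pos.2 Real.two_pi_pos).ne' ENNReal.ofReal_ne_top).1 hmain

/-- The pointwise estimate for Bergman-Orlicz functions. -/
theorem IsRegular.exists_map_le {Φ : ℝ≥0 → ℝ≥0} (h : IsRegular Φ) (hn : 1 ≤ n) {α : ℝ}
    (hα : -1 < α) :
    ∃ K : ℝ≥0, 0 < K ∧ ∀ f : CSpace n → ℂ, DifferentiableOn ℂ f (unitBall n) →
      ∀ a : CSpace n, ‖a‖ < 1 → (Φ ‖f a‖₊ : ℝ≥0∞) ≤
        K * ENNReal.ofReal ((1 / (1 - ‖a‖ ^ 2)) ^ ((n : ℝ) + 1 + α)) *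
          ∫⁻ z, Φ ‖f z‖₊ ∂(nu n α) := by
  obtain ⟨K, hK, hzero⟩ := h.exists_map_zero_le (n := n) hn hα
  have hN : 0 ≤ (n : ℝ) + 1 + α := by have := n.cast_nonneg (α := ℝ); linarith
  refine ⟨K * 4 ^ ((n : ℝ) + 1 + α), by positivity, fun f hf a ha => ?_⟩
  have hd : DifferentiableOn ℂ (fun z => f (moebius a z)) (unitBall n) :=
    hf.comp (fun z hz => (hasFDerivAt_moebius ha
      (mem_unitBall.1 hz)).differentiableAt.differentiableWithinAt)
      fun z hz => mem_unitBall.2 (norm_moebius_lt_one ha (mem_unitBall.1 hz))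
  -- The inequality at the centre for `f ∘ moebius a`; the change of variables turns its integral
  -- into that of `Φ(|f|)` times a bounded factor.
  have h1 := hzero _ hd
  rw [moebius_zero, lintegral_nu_moebius α ha] at h1
  have h3 := one_sub_norm_sq_pos ha
  have h2 : ∫⁻ z, ENNReal.ofReal (moebiusFactor a z ^ ((n : ℝ) + 1 + α)) *
      Φ ‖f (moebius a (moebius a z))‖₊ ∂(nu n α) ≤
      ∫⁻ z, ENNReal.ofReal ((4 / (1 - ‖a‖ ^ 2)) ^ ((n : ℝ) + 1 + α)) * Φ ‖f z‖₊ ∂(nu n α) := by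
    refine lintegral_mono_ae ((ae_nu_mem_unitBall α).mono fun z hz => ?_)
    rw [moebius_moebius ha hz]
    gcongr
    · unfold moebiusFactor; positivity
    · exact moebiusFactor_le ha hz
  rw [lintegral_const_mul' _ _ ENNReal.ofReal_ne_top] at h2
  refine h1.trans ((mul_le_mul_right h2 _).trans_eq ?_)
  rw [← mul_assoc]
  congr 1
  have e : (4 : ℝ) / (1 - ‖a‖ ^ 2) = 4 * (1 / (1 - ‖a‖ ^ 2)) := by ring
  rw [e, Real.mul_rpow (by norm_num) (by positivity), ENNReal.ofReal_mul (by positivity),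
    ENNReal.coe_mul, mul_assoc]
  congr 2
  rw [← ENNReal.ofReal_coe_nnreal]
  push_cast
  rfl

/-! ### Luxemburg norms and normalized pointwise bounds -/

/-- The quantity `1 - |z|²`, as a nonnegative real. -/
noncomputable def gap (z : CSpace n) : ℝ≥0 := Real.toNNReal (1 - ‖z‖ ^ 2)

theorem coe_gap {z : CSpace n} (hz : ‖z‖ < 1) : (gap z : ℝ) = 1 - ‖z‖ ^ 2 :=
  Real.coe_toNNReal _ (one_sub_norm_sq_pos hz).le

theorem gap_pos {z : CSpace n} (hz : ‖z‖ < 1) : 0 < gap z :=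
  Real.toNNReal_pos.2 (one_sub_norm_sq_pos hz)

theorem gap_le_one (z : CSpace n) : gap z ≤ 1 :=
  Real.toNNReal_le_one.2 (by nlinarith [norm_nonneg z])

theorem ofReal_one_sub_norm_sq_rpow {z : CSpace n} (hz : ‖z‖ < 1) (α : ℝ) :
    ENNReal.ofReal ((1 - ‖z‖ ^ 2) ^ α) = ((gap z ^ α : ℝ≥0) : ℝ≥0∞) := by
  rw [← coe_gap hz, ← NNReal.coe_rpow, ENNReal.ofReal_coe_nnreal]

theorem exists_gap_eq_inv (hn : 1 ≤ n) {t : ℝ≥0} (ht : 1 ≤ t) :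
    ∃ a : CSpace n, ‖a‖ < 1 ∧ gap a = t⁻¹ := by
  have ht' : (1 : ℝ) ≤ t := by exact_mod_cast ht
  have h1 : 0 < (t : ℝ)⁻¹ := by positivity
  have h2 : (t : ℝ)⁻¹ ≤ 1 := inv_le_one_of_one_le₀ ht'
  have hsq : ‖(EuclideanSpace.single ⟨0, hn⟩ (√(1 - (t : ℝ)⁻¹) : ℂ) : CSpace n)‖ ^ 2 =
      1 - (t : ℝ)⁻¹ := by
    rw [PiLp.norm_single, Complex.norm_real, Real.norm_of_nonneg (Real.sqrt_nonneg _),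
      Real.sq_sqrt (by linarith)]
  refine ⟨EuclideanSpace.single ⟨0, hn⟩ (√(1 - (t : ℝ)⁻¹) : ℂ), ?_, ?_⟩
  · refine lt_of_pow_lt_pow_left₀ 2 zero_le_one ?_
    rw [hsq]
    linarith
  · rw [gap, hsq, sub_sub_cancel, ← NNReal.coe_inv, Real.toNNReal_coe]

/-- Turns a bound on the modular into a bound on the Luxemburg norm, with `R` independent of the
measure and of the function. -/
theorem IsRegular.exists_lintegral_div_le_one {Φ : ℝ≥0 → ℝ≥0} (h : IsRegular Φ) (D : ℝ≥0) :
    ∃ R : ℝ≥0, 1 ≤ R ∧ ∀ (μ : Measure (CSpace n)) (g : CSpace n → ℝ≥0),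
      ∫⁻ z, Φ (g z) ∂μ ≤ D → ∫⁻ z, Φ (g z / R) ∂μ ≤ 1 := by
  obtain ⟨R, hR1, hR⟩ := h.exists_mul_map_div_le (D + 1)
  refine ⟨R, hR1, fun μ g hg => ?_⟩
  have h1 : ((D + 1 : ℝ≥0) : ℝ≥0∞) * ∫⁻ z, Φ (g z / R) ∂μ ≤ (D + 1 : ℝ≥0) * 1 := by
    rw [← lintegral_const_mul' _ _ ENNReal.coe_ne_top, mul_one]
    calc _ ≤ ∫⁻ z, (Φ (g z) : ℝ≥0∞) ∂μ := lintegral_mono fun z => by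
          simpa only [ENNReal.coe_mul] using ENNReal.coe_le_coe.2 (hR (g z))
      _ ≤ D := hg
      _ ≤ _ := by exact_mod_cast le_self_add
  exact (ENNReal.mul_le_mul_iff_right (by simp) ENNReal.coe_ne_top).1 h1

theorem luxNorm_le {Φ : ℝ≥0 → ℝ≥0} {α : ℝ} {f : CSpace n → ℂ} {r : ℝ≥0} (hr : 0 < r)
    (hf : ∫⁻ z, Φ (‖f z‖₊ / r) ∂(nu n α) ≤ 1) : luxNorm n Φ α f ≤ r :=
  csInf_le (OrderBot.bddBelow _) ⟨hr, hf⟩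

theorem IsRegular.nonempty_luxNorm {Φ : ℝ≥0 → ℝ≥0} (h : IsRegular Φ) {α : ℝ}
    {f : CSpace n → ℂ} (hf : f ∈ space n Φ α) :
    {r : ℝ≥0 | 0 < r ∧ ∫⁻ z, (Φ (‖f z‖₊ / r) : ℝ≥0∞) ∂(nu n α) ≤ 1}.Nonempty := by
  have hD := ENNReal.coe_toNNReal hf.2.ne
  obtain ⟨R, hR1, hR⟩ := h.exists_lintegral_div_le_one (n := n) _
  exact ⟨R, one_pos.trans_le hR1, hR _ _ hD.ge⟩

theorem IsRegular.lintegral_le_one_of_luxNorm_lt {Φ : ℝ≥0 → ℝ≥0} (h : IsRegular Φ) {α : ℝ}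
    {f : CSpace n → ℂ} (hf : f ∈ space n Φ α) {r : ℝ≥0} (hr : luxNorm n Φ α f < r) :
    ∫⁻ z, Φ (‖f z‖₊ / r) ∂(nu n α) ≤ 1 := by
  obtain ⟨r', ⟨hr0, hr'⟩, hlt⟩ := exists_lt_of_csInf_lt (h.nonempty_luxNorm hf) hr
  refine (lintegral_mono fun z => ?_).trans hr'
  exact ENNReal.coe_le_coe.2 (h.monotone (by gcongr))

theorem IsRegular.exists_map_div_le {Φ : ℝ≥0 → ℝ≥0} (h : IsRegular Φ) (hn : 1 ≤ n) {α : ℝ}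
    (hα : -1 < α) :
    ∃ K : ℝ≥0, 0 < K ∧ ∀ f : CSpace n → ℂ, DifferentiableOn ℂ f (unitBall n) →
      ∀ r : ℝ≥0, ∫⁻ z, Φ (‖f z‖₊ / r) ∂(nu n α) ≤ 1 → ∀ a : CSpace n, ‖a‖ < 1 →
        Φ (‖f a‖₊ / r) ≤ K * (gap a)⁻¹ ^ ((n : ℝ) + 1 + α) := by
  obtain ⟨K, hK, hle⟩ := h.exists_map_le (n := n) hn hα
  refine ⟨K, hK, fun f hf r hr a ha => ?_⟩
  have e : ∀ z, ‖f z / (r : ℝ)‖₊ = ‖f z‖₊ / r := fun z => by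
    rw [nnnorm_div]
    congr 1
    ext
    simp
  have h1 := hle (fun z => f z / (r : ℝ)) 
    (by simpa only [div_eq_mul_inv] using hf.mul_const _) a ha
  simp only [e] at h1
  have h2 := h1.trans (mul_le_of_le_one_right' hr)
  rw [one_div, ← coe_gap ha, ← NNReal.coe_inv, ← NNReal.coe_rpow, ENNReal.ofReal_coe_nnreal] at h2
  exact_mod_cast h2

/-! ### Sufficiency of the growth condition -/

/-- Comparison of integrals for two different weights. -/
theorem lintegral_nu_le (hn : 1 ≤ n) {α β : ℝ} (hα : -1 < α) (C : ℝ≥0) {g₁ g₂ : CSpace n → ℝ≥0}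
    (hg : ∀ z, ‖z‖ < 1 → g₂ z ≤ C * gap z ^ (α - β) * g₁ z) :
    ∫⁻ z, g₂ z ∂(nu n β) ≤
      (weight n β Set.univ)⁻¹ * (C * (weight n α Set.univ * ∫⁻ z, g₁ z ∂(nu n α))) := by
  rw [lintegral_nu, lintegral_nu, ← mul_assoc (weight n α Set.univ),
    ENNReal.mul_inv_cancel (weight_univ_ne_zero n α) (weight_univ_lt_top hn hα).ne, one_mul,
    lintegral_weight, lintegral_weight, ← lintegral_const_mul' _ _ ENNReal.coe_ne_top]
  gcongr 1
  refine setLIntegral_mono' measurableSet_unitBall fun z hz => ?_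
  rw [mem_unitBall] at hz
  rw [ofReal_one_sub_norm_sq_rpow hz, ofReal_one_sub_norm_sq_rpow hz]
  norm_cast
  calc gap z ^ β * g₂ z ≤ gap z ^ β * (C * gap z ^ (α - β) * g₁ z) := by gcongr; exact hg z hz
    _ = C * (gap z ^ (β + (α - β)) * g₁ z) := by rw [NNReal.rpow_add (gap_pos hz).ne']; ring
    _ = _ := by rw [add_sub_cancel]

/-- The growth condition on the inverses bounds `Φ₂` by `Φ₁` below the level `inv Φ₁ (u⁻¹ ^ A)`. -/
theorem map_le_mul_map_of_inv_le {Φ₁ Φ₂ : ℝ≥0 → ℝ≥0} (h₁ : IsRegular Φ₁) (h₂ : IsRegular Φ₂)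
    (hmono : MonotoneOn (fun t => Φ₂ t / Φ₁ t) (Set.Ioi 0)) {A B : ℝ} {C u x : ℝ≥0} (hu : 0 < u)
    (hinv : inv Φ₁ (u⁻¹ ^ A) ≤ inv Φ₂ (C * u⁻¹ ^ B)) (hx : x ≤ inv Φ₁ (u⁻¹ ^ A)) :
    Φ₂ x ≤ C * u ^ (A - B) * Φ₁ x := by
  rcases eq_or_ne x 0 with rfl | hx0
  · simp [h₂.map_zero]
  have hx' : 0 < x := pos_iff_ne_zero.2 hx0
  have hy := hx'.trans_le hx
  have h3 := hmono (Set.mem_Ioi.2 hx') (Set.mem_Ioi.2 hy) hx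
  -- The ratio `Φ₂/Φ₁` at `x` is at most its value at `inv Φ₁ (u⁻¹ ^ A)`, where `Φ₁` equals `u⁻¹ ^
  -- A` and `Φ₂` is at most `C * u⁻¹ ^ B`.
  simp only at h3
  rw [div_le_div_iff₀ (h₁.pos _ hx') (h₁.pos _ hy), h₁.map_inv] at h3
  have h4 := (h₂.monotone hinv).trans_eq (h₂.map_inv _)
  have hA : 0 < u⁻¹ ^ A := NNReal.rpow_pos (by positivity)
  refine le_of_mul_le_mul_right (h3.trans ?_) hA
  calc Φ₂ (inv Φ₁ (u⁻¹ ^ A)) * Φ₁ x ≤ C * u⁻¹ ^ B * Φ₁ x := by gcongr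
    _ = _ := by
      have : u⁻¹ ^ B = u ^ (A - B) * u⁻¹ ^ A := by
        rw [NNReal.inv_rpow, NNReal.inv_rpow, NNReal.rpow_sub hu.ne']
        have : u ^ A ≠ 0 := (NNReal.rpow_pos hu).ne'
        field_simp
      rw [this]
      ring

theorem embedsContinuously_of_inv_le (hn : 1 ≤ n) {Φ₁ Φ₂ : ℝ≥0 → ℝ≥0} (h₁ : IsRegular Φ₁)
    (h₂ : IsRegular Φ₂) (hmono : MonotoneOn (fun t => Φ₂ t / Φ₁ t) (Set.Ioi 0)) {α β : ℝ}
    (hα : -1 < α) {C : ℝ≥0}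
    (hC : ∀ t : ℝ≥0, 1 ≤ t →
      inv Φ₁ (t ^ ((n : ℝ) + 1 + α)) ≤ inv Φ₂ (C * t ^ ((n : ℝ) + 1 + β))) :
    EmbedsContinuously n Φ₁ α Φ₂ β := by
  obtain ⟨K, -, hK⟩ := h₁.exists_map_div_le (n := n) hn hα
  obtain ⟨M, hM1, hM⟩ := h₁.exists_le_mul_of_map_le K
  have hM0 : 0 < M := one_pos.trans_le hM1
  have hDtop : (weight n β Set.univ)⁻¹ * (C * (weight n α Set.univ * 1)) ≠ ∞ :=
    ENNReal.mul_ne_top (ENNReal.inv_ne_top.2 (weight_univ_ne_zero n β))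
      (ENNReal.mul_ne_top ENNReal.coe_ne_top
        (ENNReal.mul_ne_top (weight_univ_lt_top hn hα).ne ENNReal.one_ne_top))
  obtain ⟨D, hD⟩ : ∃ D : ℝ≥0, (D : ℝ≥0∞) = _ := ⟨_, ENNReal.coe_toNNReal hDtop⟩
  have key : ∀ f : CSpace n → ℂ, DifferentiableOn ℂ f (unitBall n) → ∀ r : ℝ≥0,
      ∫⁻ z, Φ₁ (‖f z‖₊ / r) ∂(nu n α) ≤ 1 → ∫⁻ z, Φ₂ (‖f z‖₊ / r / M) ∂(nu n β) ≤ D := by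
    intro f hf r hr
    have hpt : ∀ z : CSpace n, ‖z‖ < 1 →
        Φ₂ (‖f z‖₊ / r / M) ≤ C * gap z ^ (α - β) * Φ₁ (‖f z‖₊ / r / M) := by
      intro z hz
      have hle := hM (‖f z‖₊ / r) (inv Φ₁ ((gap z)⁻¹ ^ ((n : ℝ) + 1 + α)))
        (by rw [h₁.map_inv]; exact hK f hf r hr z hz)
      have := map_le_mul_map_of_inv_le h₁ h₂ hmono (gap_pos hz)
        (hC _ ((one_le_inv₀ (gap_pos hz)).2 (gap_le_one z)))
        ((div_le_iff₀' hM0).2 hle)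
      rwa [add_sub_add_left_eq_sub] at this
    refine (lintegral_nu_le hn hα C hpt).trans ?_
    rw [hD]
    gcongr
    refine (lintegral_mono fun z => ?_).trans hr
    exact ENNReal.coe_le_coe.2 (h₁.monotone (div_le_self zero_le hM1))
  obtain ⟨R, hR1, hR⟩ := h₂.exists_lintegral_div_le_one (n := n) D
  have hR0 : 0 < R := one_pos.trans_le hR1
  refine ⟨fun f hf => ⟨hf.1, ?_⟩, M * R, by positivity, fun f hf => ?_⟩
  · obtain ⟨r, hr0, hr⟩ := h₁.nonempty_luxNorm hf
    obtain ⟨K', -, hK'⟩ := h₂.exists_map_mul_le (r * M)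
    calc ∫⁻ z, (Φ₂ ‖f z‖₊ : ℝ≥0∞) ∂(nu n β)
        ≤ ∫⁻ z, K' * (Φ₂ (‖f z‖₊ / r / M) : ℝ≥0∞) ∂(nu n β) := by
          refine lintegral_mono fun z => ?_
          have := hK' (‖f z‖₊ / r / M)
          rw [div_div, mul_div_cancel₀ _ (by positivity)] at this
          rw [div_div]
          simpa only [ENNReal.coe_mul] using ENNReal.coe_le_coe.2 this
      _ = K' * ∫⁻ z, (Φ₂ (‖f z‖₊ / r / M) : ℝ≥0∞) ∂(nu n β) :=
          lintegral_const_mul' _ _ ENNReal.coe_ne_top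
      _ ≤ K' * D := by gcongr; exact key f hf.1 r hr
      _ < ∞ := by exact_mod_cast ENNReal.coe_lt_top
  · rw [mul_comm (M * R), ← div_le_iff₀ (by positivity)]
    refine le_csInf (h₁.nonempty_luxNorm hf) fun r hr => ?_
    rw [div_le_iff₀ (by positivity)]
    refine luxNorm_le (by have := hr.1; positivity) ?_
    have := hR _ _ (key f hf.1 r hr.2)
    simpa only [div_div, mul_assoc] using this

/-! ### Test functions and necessity -/

/-- Test functions peaking at a given point of the ball. -/
theorem IsRegular.exists_test_function {Φ : ℝ≥0 → ℝ≥0} (h : IsRegular Φ) (hn : 1 ≤ n) {α : ℝ}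
    (hα : -1 < α) :
    ∃ R c : ℝ≥0, 0 < c ∧ ∀ a : CSpace n, ‖a‖ < 1 → ∃ f ∈ space n Φ α, luxNorm n Φ α f ≤ R ∧
      ‖f a‖₊ = c * inv Φ ((gap a)⁻¹ ^ ((n : ℝ) + 1 + α)) := by
  have := isProbabilityMeasure_nu hn hα
  set N : ℝ := (n : ℝ) + 1 + α with hN
  have hN0 : 0 ≤ N := by have := n.cast_nonneg (α := ℝ); linarith
  obtain ⟨p, C, hp, hC0, hC⟩ := h.lower
  have hp' : (0 : ℝ) < p := by exact_mod_cast hp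
  -- With `k p ≥ 2N` and `|b| ≤ 1`, lower type gives `Φ(M |b|^k) ≤ C |b|^{2N} Φ(M)`, and `Φ(M) =
  -- (gap a)^{-N}` makes this at most `C` times the Jacobian factor `moebiusFactor ^ N`.
  obtain ⟨k, hk⟩ := exists_nat_ge (2 * N / p)
  rw [div_le_iff₀ hp'] at hk
  obtain ⟨R, hR1, hR⟩ := h.exists_lintegral_div_le_one (n := n) C
  refine ⟨R, (1 / 2) ^ k, by positivity, fun a ha => ?_⟩
  set M := inv Φ ((gap a)⁻¹ ^ N) with hM
  have hs : (defect a : ℂ) ≠ 0 := by exact_mod_cast (defect_pos ha).ne'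
  have hgap : (gap a : ℝ) = defect a ^ 2 := by rw [coe_gap ha, defect_sq ha]
  -- The `2` ensures `|b| ≤ 1`, since `1 - |a|² ≤ 2 (1 - |a|)`; it makes `b a = 1/2`, whence the
  -- constant `(1/2)^k`.
  set b : CSpace n → ℂ := fun z => (defect a : ℂ) ^ 2 / (2 * (1 - inner ℂ a z)) with hb
  have hbn : ∀ z, ‖b z‖ = defect a ^ 2 / (2 * ‖1 - inner ℂ a z‖) := fun z => by
    simp only [hb, norm_div, norm_pow, norm_mul, Complex.norm_real, Real.norm_eq_abs, sq_abs,
      Complex.norm_ofNat]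
  have hb1 : ∀ z : CSpace n, ‖z‖ < 1 → ‖b z‖₊ ≤ 1 := fun z hz => by
    have h1 := one_sub_norm_le_norm_one_sub_inner (a := a) hz
    have h2 := norm_pos_iff.2 (one_sub_inner_ne_zero ha hz)
    rw [← NNReal.coe_le_coe, coe_nnnorm, hbn, NNReal.coe_one, div_le_one (by positivity),
      defect_sq ha]
    nlinarith [norm_nonneg a]
  have hbd : DifferentiableOn ℂ b (unitBall n) := by
    simp only [hb, div_eq_mul_inv]
    exact (DifferentiableOn.inv
      (((innerSL ℂ a).differentiable.const_sub 1).const_mul 2).differentiableOn fun z hz =>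
        mul_ne_zero two_ne_zero (one_sub_inner_ne_zero ha (mem_unitBall.1 hz))).const_mul _
  set f : CSpace n → ℂ := fun z => (M : ℝ) * b z ^ k with hf
  have hfd : DifferentiableOn ℂ f (unitBall n) := (hbd.pow k).const_mul _
  have hfn : ∀ z, ‖f z‖₊ = M * ‖b z‖₊ ^ k := fun z => by
    rw [hf]
    simp only [nnnorm_mul, nnnorm_pow]
    congr 1
    ext
    simp
  have hpt : ∀ z : CSpace n, ‖z‖ < 1 →
      (Φ ‖f z‖₊ : ℝ≥0∞) ≤ C * ENNReal.ofReal (moebiusFactor a z ^ N) := by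
    intro z hz
    have hm0 : 0 ≤ moebiusFactor a z := by unfold moebiusFactor; positivity
    have e : (‖b z‖₊ ^ k) ^ (p : ℝ) * (gap a)⁻¹ ^ N ≤ Real.toNNReal (moebiusFactor a z) ^ N := by
      calc (‖b z‖₊ ^ k) ^ (p : ℝ) * (gap a)⁻¹ ^ N = ‖b z‖₊ ^ (k * p : ℝ) * (gap a)⁻¹ ^ N := by
            rw [← NNReal.rpow_natCast, ← NNReal.rpow_mul]
        _ ≤ ‖b z‖₊ ^ (2 * N) * (gap a)⁻¹ ^ N := by
            gcongr 1
            rcases eq_or_ne ‖b z‖₊ 0 with h0 | h0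
            · have := hbn z
              have h2 := norm_pos_iff.2 (one_sub_inner_ne_zero ha hz)
              have h3 := defect_pos ha
              have : 0 < ‖b z‖ := by rw [this]; positivity
              simp at h0
              simp [h0] at this
            · exact NNReal.rpow_le_rpow_of_exponent_ge (pos_iff_ne_zero.2 h0) (hb1 z hz) hk
        _ = (‖b z‖₊ ^ 2 * (gap a)⁻¹) ^ N := by
            rw [NNReal.rpow_mul, NNReal.mul_rpow, NNReal.rpow_two]
        _ ≤ _ := by
            refine NNReal.rpow_le_rpow ?_ hN0
            rw [← NNReal.coe_le_coe, Real.coe_toNNReal _ hm0]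
            push_cast
            rw [hbn, hgap, moebiusFactor]
            have h2 := norm_pos_iff.2 (one_sub_inner_ne_zero ha hz)
            have h3 := defect_pos ha
            rw [div_pow, mul_pow]
            calc (defect a ^ 2) ^ 2 / (2 ^ 2 * ‖1 - inner ℂ a z‖ ^ 2) * (defect a ^ 2)⁻¹
                = (defect a ^ 2 / ‖1 - inner ℂ a z‖ ^ 2) / 4 := by field_simp; norm_num
              _ ≤ _ := div_le_self (by positivity) (by norm_num)
    have h1 := hC M (‖b z‖₊ ^ k) (pow_le_one' (hb1 z hz) k)
    rw [← hfn, h.map_inv, mul_assoc] at h1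
    have h2 : Φ ‖f z‖₊ ≤ C * Real.toNNReal (moebiusFactor a z) ^ N := h1.trans (by gcongr)
    have e2 : ENNReal.ofReal (moebiusFactor a z ^ N) =
        ((Real.toNNReal (moebiusFactor a z) ^ N : ℝ≥0) : ℝ≥0∞) := by
      rw [ENNReal.ofReal, Real.toNNReal_rpow_of_nonneg hm0]
    rw [e2]
    exact_mod_cast h2
  have hint : ∫⁻ z, (Φ ‖f z‖₊ : ℝ≥0∞) ∂(nu n α) ≤ C := by
    -- The change of variables for the constant `1` shows that `moebiusFactor ^ N` has integral `1`.
    have h1 := lintegral_nu_moebius α ha (fun _ => 1)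
    simp only [lintegral_one, measure_univ, mul_one] at h1
    calc _ ≤ ∫⁻ z, C * ENNReal.ofReal (moebiusFactor a z ^ N) ∂(nu n α) :=
          lintegral_mono_ae ((ae_nu_mem_unitBall α).mono hpt)
      _ = C := by rw [lintegral_const_mul' _ _ ENNReal.coe_ne_top, ← h1, mul_one]
  refine ⟨f, ⟨hfd, hint.trans_lt ENNReal.coe_lt_top⟩,
    luxNorm_le (one_pos.trans_le hR1) (hR _ _ hint), ?_⟩
  have hba : ‖b a‖₊ = 1 / 2 := by
    have : b a = 1 / 2 := by
      simp only [hb, inner_self_eq ha]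
      field_simp
      ring
    rw [this]
    simp
  rw [hfn, hba, mul_comm]

theorem inv_le_of_embedsContinuously (hn : 1 ≤ n) {Φ₁ Φ₂ : ℝ≥0 → ℝ≥0} (h₁ : IsRegular Φ₁)
    (h₂ : IsRegular Φ₂) {α β : ℝ} (hα : -1 < α) (hβ : -1 < β)
    (hemb : EmbedsContinuously n Φ₁ α Φ₂ β) :
    ∃ C : ℝ≥0, 0 < C ∧ ∀ t : ℝ≥0, 1 ≤ t →
      inv Φ₁ (t ^ ((n : ℝ) + 1 + α)) ≤ inv Φ₂ (C * t ^ ((n : ℝ) + 1 + β)) := by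
  obtain ⟨hsub, L, -, hL⟩ := hemb
  obtain ⟨R, c, hc, htest⟩ := h₁.exists_test_function (n := n) hn hα
  obtain ⟨K, -, hK⟩ := h₂.exists_map_div_le (n := n) hn hβ
  have hr : 0 < L * R + 1 := by positivity
  obtain ⟨D, -, hD⟩ := h₂.exists_map_mul_le ((L * R + 1) / c)
  -- The extra `1` gives the strict inequality that `le_inv_of_map_lt` needs; likewise `L * R + 1`
  -- strictly exceeds the norm, so the infimum need not be attained.
  refine ⟨D * K + 1, by positivity, fun t ht => ?_⟩
  obtain ⟨a, ha, hat⟩ := exists_gap_eq_inv (n := n) hn ht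
  obtain ⟨f, hf, hfR, hfa⟩ := htest a ha
  rw [hat, inv_inv] at hfa
  have hlt : luxNorm n Φ₂ β f < L * R + 1 :=
    ((hL f hf).trans (by gcongr)).trans_lt (lt_add_one _)
  have h3 := hK f hf.1 _ (h₂.lintegral_le_one_of_luxNorm_lt (hsub hf) hlt) a ha
  rw [hat, inv_inv] at h3
  have h4 := hD (‖f a‖₊ / (L * R + 1))
  have e : (L * R + 1) / c * (‖f a‖₊ / (L * R + 1)) = inv Φ₁ (t ^ ((n : ℝ) + 1 + α)) := by
    rw [hfa]
    field_simp
  rw [e] at h4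
  refine h₂.le_inv_of_map_lt (h4.trans_lt ?_)
  have ht0 : 0 < t ^ ((n : ℝ) + 1 + β) := NNReal.rpow_pos (one_pos.trans_le ht)
  calc D * Φ₂ (‖f a‖₊ / (L * R + 1)) ≤ D * (K * t ^ ((n : ℝ) + 1 + β)) := by gcongr
    _ < (D * K + 1) * t ^ ((n : ℝ) + 1 + β) := by
      rw [add_mul, one_mul, mul_assoc]
      exact lt_add_of_pos_right _ ht0

end BergmanOrlicz

theorem theorem6 (n : ℕ) (hn : 1 ≤ n) (Φ₁ Φ₂ : ℝ≥0 → ℝ≥0)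
    (hΦ₁ : Φ₁ ∈ BergmanOrlicz.classL ∪ BergmanOrlicz.classU)
    (hΦ₂ : Φ₂ ∈ BergmanOrlicz.classL ∪ BergmanOrlicz.classU)
    (hmono : MonotoneOn (fun t => Φ₂ t / Φ₁ t) (Set.Ioi 0))
    (α β : ℝ) (hα : -1 < α) (hβ : -1 < β) :
    BergmanOrlicz.EmbedsContinuously n Φ₁ α Φ₂ β ↔
      ∃ C : ℝ≥0, 0 < C ∧ ∀ t : ℝ≥0, 1 ≤ t →
        BergmanOrlicz.inv Φ₁ (t ^ ((n : ℝ) + 1 + α)) ≤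
          BergmanOrlicz.inv Φ₂ (C * t ^ ((n : ℝ) + 1 + β)) := by
  have h₁ := BergmanOrlicz.IsRegular.of_mem hΦ₁
  have h₂ := BergmanOrlicz.IsRegular.of_mem hΦ₂
  exact ⟨BergmanOrlicz.inv_le_of_embedsContinuously hn h₁ h₂ hα hβ, fun ⟨_, _, hC⟩ =>
    BergmanOrlicz.embedsContinuously_of_inv_le hn h₁ h₂ hmono hα hC⟩
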